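/- Let $G$ be a simple algebraic group over $\mathbb{C}$ with Lie algebra $\mathfrak{g}$, and let $G$ act on $\mathfrak{g}$ by the adjoint action $g.z=\mathrm{Ad}(g)(z)$. Let $T\subseteq B$ be a maximal torus and a Borel subgroup, with Lie algebras $\mathfrak{t}\subseteq\mathfrak{b}$; let $\mathfrak{u}$ be the nilradical of $\mathfrak{b}$, $\Phi$ the root system of $(\mathfrak{g},\mathfrak{t})$, $\Phi^+$ and $\Delta$ the positive and simple roots determined by $B$, $W=N_G(T)/T$ the Weyl group, and $\ell$ the length function on $W$ with respect to the simple reflections $s_\alpha$, $\alpha\in\Delta$. For $w\in W$ write $w.\mathfrak{u}$ for $n.\mathfrak{u}$, where $n\in N_G(T)$ is any representative of $w$. Let $x\in\mathfrak{g}$ be a nonzero nilpotent element, completed to an $\mathfrak{sl}_2$-triple $\{x,h,y\}$, that is $[h,x]=2x$, $[h,y]=-2y$, $[x,y]=h$, and conjugated so that $h\in\mathfrak{t}$ and $\alpha(h)\ge 0$ for all $\alpha\in\Delta$. For $j\in\mathbb{Z}$ put $\mathfrak{g}_j=\{z\in\mathfrak{g}\mid [h,z]=jz\}$. Let $G_0$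 be the connected subgroup of $G$ with Lie algebra $\mathfrak{g}_0$, let $B_0=B\cap G_0$, let $W_0=\langle s_\alpha\mid \alpha\in\Delta,\ \alpha(h)=0\rangle\subseteq W$, and let $W^0\subseteq W$ be the set of elements $w$ of minimal length in their right coset $W_0w$. Then for every linear subspace $U\subseteq\mathfrak{g}_2$ with $B_0.U=U$ there exists $w\in W^0$ such that $U=w.\mathfrak{u}\cap\mathfrak{g}_2$. -/

import Mathlib

open LieAlgebra LieAlgebra.IsKilling LieModule Module
open scoped ComplexOrder

noncomputable section

namespace NilpotentGrading

/-- The exponential `∑ fⁿ / n!` of an endomorphism of a finite-dimensional complex vector space,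
computed in matrix form (the result does not depend on the basis, since `exp` commutes with
conjugation). -/
def endExp {V : Type*} [AddCommGroup V] [Module ℂ V] [FiniteDimensional ℂ V]
    (f : V →ₗ[ℂ] V) : V →ₗ[ℂ] V :=
  (LinearMap.toMatrixAlgEquiv (finBasis ℂ V)).symm
    (NormedSpace.exp (LinearMap.toMatrixAlgEquiv (finBasis ℂ V) f))

variable {𝔤 : Type*} [LieRing 𝔤] [LieAlgebra ℂ 𝔤] [FiniteDimensional ℂ 𝔤]

/-- Let `G` be a connected complex algebraic group with Lie algebra `𝔤`. For a Lie subalgebra `𝔥`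
of `𝔤` which is the Lie algebra of a connected closed subgroup `K` of `G`, this is the group
`Ad(K)` of linear automorphisms of `𝔤`: the group `K` is generated by the elements `exp z`,
`z ∈ 𝔥`, and `Ad(exp z) = exp(ad z)`. -/
def adGroup (𝔥 : Submodule ℂ 𝔤) : Subgroup (𝔤 ≃ₗ[ℂ] 𝔤) :=
  Subgroup.closure {g | ∃ z ∈ 𝔥, (g : 𝔤 →ₗ[ℂ] 𝔤) = endExp (ad ℂ 𝔤 z)}

/-- The graded piece `𝔤_j = {z | [h, z] = j z}`. -/
def gradedPiece (h : 𝔤) (j : ℤ) : Submodule ℂ 𝔤 :=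
  (ad ℂ 𝔤 h).eigenspace (j : ℂ)

variable [IsKilling ℂ 𝔤] {𝔱 : LieSubalgebra ℂ 𝔤} [𝔱.IsCartanSubalgebra]

/-- `𝔲`, the sum of the root spaces of the positive roots. -/
def nilradical (b : (rootSystem 𝔱).Base) : Submodule ℂ 𝔤 :=
  ⨆ i : {i : 𝔱.root // b.IsPos i}, (rootSpace 𝔱 (i.1.1 : 𝔱 → ℂ)).toSubmodule

/-- The Borel subalgebra `𝔟 = 𝔱 ⊕ 𝔲`. -/
def borel (b : (rootSystem 𝔱).Base) : Submodule ℂ 𝔤 :=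
  𝔱.toSubmodule ⊔ nilradical b

/-- (The image under `Ad` of) `B₀ = B ∩ G₀`, where `B` and `G₀` are the connected subgroups with
Lie algebras `𝔟` and `𝔤₀`. Both contain the kernel of `Ad`, so that `Ad` respects the
intersection. -/
def borelZero (b : (rootSystem 𝔱).Base) (h : 𝔱) : Subgroup (𝔤 ≃ₗ[ℂ] 𝔤) :=
  adGroup (borel b) ⊓ adGroup (gradedPiece (h : 𝔤) 0)

/-- The length of `w ∈ W`: the minimal length of a word in the simple reflections with
product `w`. -/
def length (b : (rootSystem 𝔱).Base) (w : (rootSystem 𝔱).weylGroup) : ℕ :=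
  sInf {n | ∃ l : List 𝔱.root, l.length = n ∧ (∀ i ∈ l, i ∈ b.support) ∧
    (l.map (RootPairing.weylGroup.ofIdx (rootSystem 𝔱))).prod = w}

/-- `W₀`, the subgroup of `W` generated by the reflections in the simple roots `α` with
`𝔤_α ⊆ 𝔤₀`, that is with `α(h) = 0`. -/
def weylZero (b : (rootSystem 𝔱).Base) (h : 𝔱) : Subgroup (rootSystem 𝔱).weylGroup :=
  Subgroup.closure {s | ∃ i ∈ b.support, (rootSystem 𝔱).root i h = 0 ∧
    s = RootPairing.weylGroup.ofIdx (rootSystem 𝔱) i}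

/-- `W⁰`: the elements of `W` of shortest length in their right coset `W₀ w`. -/
def minimalCosetReps (b : (rootSystem 𝔱).Base) (h : 𝔱) : Set (rootSystem 𝔱).weylGroup :=
  {w | ∀ u ∈ weylZero b h, length b w ≤ length b (u * w)}

/-- `n` is (the image under `Ad` of) a representative in `N_G(T)` of `w ∈ W = N_G(T) / T`:
it lies in `Ad(G)`, maps `𝔱` to itself, and acts there as `w`, that is `(w α)(n t) = α(t)` for every
root `α` and every `t ∈ 𝔱`. -/
def Represents (n : 𝔤 ≃ₗ[ℂ] 𝔤) (w : (rootSystem 𝔱).weylGroup) : Prop :=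
  n ∈ adGroup (⊤ : Submodule ℂ 𝔤) ∧
    ∀ t : 𝔱, ∃ t' : 𝔱, n (t : 𝔤) = (t' : 𝔤) ∧
      ∀ i : 𝔱.root, (rootSystem 𝔱).root ((rootSystem 𝔱).weylGroupToPerm w i) t' =
        (rootSystem 𝔱).root i t

end NilpotentGrading

end

/-!
The subspace `U` is stable under `exp (ad z)` for all multiples `z` of any element of `𝔟 ∩ 𝔤₀`, hence
under `ad z`, the derivative of this one-parameter group. Taking `z ∈ 𝔱` shows that `U` is the sum of
the root spaces `𝔤_α`, `α ∈ S`, for a set `S` of roots with `α(h) = 2`. Taking `z` in a positive root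
space of degree zero shows that `S` is stable under adding positive roots of degree zero, because the
bracket of two root spaces is nonzero when the sum of the roots is a root.

It remains to find a positive system `C = w Φ⁺` which contains the positive roots of degree zero and
whose roots of degree `2` are exactly those in `S`. Equivalently, `C` contains the set `A` consisting
of the positive roots of degree zero, the members of `S`, and the negatives of the roots of degree
`2` outside `S`. The point is that no nonempty sum of members of `A` vanishes
(`RootPairing.Base.isPointed_of_stable`). Such a relation would say that a sum of `n` members of `S`
and of some positive roots of degree zero equals a sum of `n` roots of degree `2` outside `S`. The
invariant form is positive on this vector, so that a root on the left and one on the right make an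
acute angle, and their difference is a root (or zero). As `S` is stable, this difference can be used
to shorten the relation, until only a sum of positive roots equal to zero remains
(`RootPairing.Base.eq_zero_of_sum_eq`). A maximal set with this property containing `A` is a positive
system, and reflecting in simple roots which it lacks turns it into `Φ⁺`; this gives `w` together
with a word whose length is the number of positive roots outside `C`
(`RootPairing.IsPointed.exists_word_isPos`).

That number counts the inversions of `w`, and is a lower bound for the length of any word for `w`.
All inversions have nonzero degree since `C` contains the positive roots of degree zero, and `u ∈ W₀`
permutes the positive roots of nonzero degree; so `u` maps the inversions of `w` to inversions of
`u w`, whence `w` is shortest in `W₀ w`.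

On the side of the group, the exponential of a derivation is an automorphism of `𝔤`
(`NilpotentGrading.endExp_ad_lie`), the products `exp(ad e) exp(-ad f) exp(ad e)` represent the
reflections, and a representative of `w` maps `𝔤_α` onto `𝔤_{wα}`. Both `U` and `w.𝔲 ∩ 𝔤₂` are
`𝔱`-stable subspaces of `𝔤₂`, and thus agree because they contain the same root spaces.
-/

/-! ### Positive systems of a root pairing -/

namespace RootPairing

variable {ι R M N : Type*} [Field R] [AddCommGroup M] [Module R M]
  [AddCommGroup N] [Module R N] {P : RootPairing ι R M N}

lemma root_reflectionPerm_self (P : RootPairing ι R M N) (i : ι) :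
    P.root (P.reflectionPerm i i) = -P.root i := by
  rw [root_reflectionPerm, reflection_apply_self]

/-- A set of roots (given by their indices) is pointed if no sum of finitely many of its members,
with at least one summand, vanishes. -/
def IsPointed (P : RootPairing ι R M N) (A : Set ι) : Prop :=
  ∀ m : Multiset ι, (∀ i ∈ m, i ∈ A) → (m.map P.root).sum = 0 → m = 0

/-- If a pointed set ceases to be pointed when `i` is added, then some positive multiple of `-i` is a
sum of members. -/
lemma IsPointed.exists_of_not_insert {C : Set ι} (hC : IsPointed P C) {i : ι}
    (hi : ¬ IsPointed P (insert i C)) :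
    ∃ k : ℕ, k ≠ 0 ∧ ∃ m : Multiset ι, (∀ j ∈ m, j ∈ C) ∧
      k • P.root i + (m.map P.root).sum = 0 := by
  classical
  simp only [IsPointed, not_forall] at hi
  obtain ⟨m, hm, hs, h0⟩ := hi
  have key : (m.filter (i = ·)) + m.filter (fun x ↦ ¬ i = x) = m := Multiset.filter_add_not _ _
  rw [Multiset.filter_eq] at key
  have hmem : ∀ j ∈ m.filter (fun x ↦ ¬ i = x), j ∈ C := by
    intro j hj
    rw [Multiset.mem_filter] at hj
    exact (hm j hj.1).resolve_left (Ne.symm hj.2)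
  refine ⟨m.count i, fun hc ↦ h0 ?_, _, hmem, ?_⟩
  · rw [hc, Multiset.replicate_zero, zero_add] at key
    rw [key] at hmem
    exact hC m hmem hs
  · rw [← hs]
    conv_rhs => rw [← key]
    simp

/-- Every pointed set is contained in a pointed set which contains one of every pair of opposite
roots: a maximal pointed set has this property. -/
lemma IsPointed.exists_total [CharZero R] [Finite ι] {A : Set ι} (hA : IsPointed P A) :
    ∃ C, A ⊆ C ∧ IsPointed P C ∧ ∀ i, i ∈ C ∨ P.reflectionPerm i i ∈ C := by
  obtain ⟨C, hAC, hC⟩ := (Set.toFinite {C | IsPointed P C}).exists_le_maximal hA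
  refine ⟨C, hAC, hC.prop, fun i ↦ ?_⟩
  by_contra! h
  have aux : ∀ j, j ∉ C → ¬ IsPointed P (insert j C) := fun j hj hp ↦
    hj (hC.le_of_ge hp (Set.subset_insert j C) (Set.mem_insert j C))
  obtain ⟨k, hk, m, hm, hs⟩ := hC.prop.exists_of_not_insert (aux _ h.1)
  obtain ⟨k', hk', m', hm', hs'⟩ := hC.prop.exists_of_not_insert (aux _ h.2)
  rw [root_reflectionPerm_self] at hs'
  have h1 : k' • m + k • m' = 0 := by
    refine hC.prop _ (fun j hj ↦ ?_) ?_
    · rcases Multiset.mem_add.mp hj with hj | hj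
      · exact hm j (Multiset.mem_of_mem_nsmul hj)
      · exact hm' j (Multiset.mem_of_mem_nsmul hj)
    · rw [Multiset.map_add, Multiset.sum_add, Multiset.map_nsmul, Multiset.map_nsmul,
        Multiset.sum_nsmul, Multiset.sum_nsmul, eq_neg_of_add_eq_zero_right hs,
        eq_neg_of_add_eq_zero_right hs']
      module
  have h2 : m = 0 := by
    rw [add_eq_zero] at h1
    by_contra h3
    obtain ⟨j, hj⟩ := Multiset.exists_mem_of_ne_zero h3
    have : j ∈ k' • m := (Multiset.mem_nsmul_of_ne_zero hk').mpr hj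
    simp [h1.1] at this
  rw [h2, Multiset.map_zero, Multiset.sum_zero, add_zero, ← Nat.cast_smul_eq_nsmul R,
    smul_eq_zero] at hs
  exact hs.elim (by exact_mod_cast hk) (P.ne_zero i)

/-- A total pointed set is closed: if `i + j` were not in it, then `i`, `j` and `-(i + j)` would be
members with sum zero. -/
lemma IsPointed.add_mem {C : Set ι} (hC : IsPointed P C)
    (htot : ∀ i, i ∈ C ∨ P.reflectionPerm i i ∈ C) {i j k : ι} (hi : i ∈ C) (hj : j ∈ C)
    (hk : P.root k = P.root i + P.root j) : k ∈ C := by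
  refine (htot k).resolve_right fun h ↦ ?_
  have := hC {i, j, P.reflectionPerm k k} (by simp [hi, hj, h]) (by
    simp only [Multiset.insert_eq_cons, Multiset.map_cons, Multiset.map_singleton,
      Multiset.sum_cons, Multiset.sum_singleton, root_reflectionPerm_self, hk]
    abel)
  simp at this

lemma IsPointed.reflectionPerm_notMem {C : Set ι} (hC : IsPointed P C) {i : ι} (hi : i ∈ C) :
    P.reflectionPerm i i ∉ C := by
  intro h
  have := hC {i, P.reflectionPerm i i} (by simp [hi, h]) (by simp)
  simp at this

lemma IsPointed.preimage_reflectionPerm {C : Set ι} (hC : IsPointed P C) (j : ι) :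
    IsPointed P (P.reflectionPerm j ⁻¹' C) := by
  intro m hm hs
  have : m.map (P.reflectionPerm j) = 0 := by
    refine hC _ (fun i hi ↦ ?_) ?_
    · obtain ⟨a, ha, rfl⟩ := Multiset.mem_map.mp hi
      exact hm a ha
    · rw [Multiset.map_map]
      have : (P.root ∘ P.reflectionPerm j) = fun i ↦ (P.reflection j) (P.root i) := by
        ext i
        exact root_reflectionPerm ..
      rw [this, show m.map (fun i ↦ P.reflection j (P.root i)) = (m.map P.root).map (P.reflection j) by
        rw [Multiset.map_map]; rfl, ← map_multiset_sum, hs, map_zero]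
  simpa using this

lemma reflectionPerm_reflectionPerm_self (P : RootPairing ι R M N) (i j : ι) :
    P.reflectionPerm j (P.reflectionPerm i i) =
      P.reflectionPerm (P.reflectionPerm j i) (P.reflectionPerm j i) := by
  apply P.root.injective
  rw [root_reflectionPerm_self, root_reflectionPerm, root_reflectionPerm_self, map_neg,
    root_reflectionPerm]

lemma Base.isPos_reflectionPerm_self [CharZero R] (b : P.Base) (i : ι) :
    b.IsPos (P.reflectionPerm i i) ↔ ¬ b.IsPos i :=
  Base.IsPos.neg_iff_not b i

lemma weylGroupToPerm_ofIdx (P : RootPairing ι R M N) (i j : ι) :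
    P.weylGroupToPerm (weylGroup.ofIdx P i) j = P.reflectionPerm i j := rfl

lemma weylGroup_ofIdx_mul_self (P : RootPairing ι R M N) (i : ι) :
    weylGroup.ofIdx P i * weylGroup.ofIdx P i = 1 := by
  have h := Equiv.reflection_inv P i
  refine Subtype.ext ?_
  change Equiv.reflection P i * Equiv.reflection P i = 1
  rw [← h]
  nth_rewrite 2 [h]
  exact inv_mul_cancel _

lemma weylGroup_ofIdx_reflectionPerm (P : RootPairing ι R M N) (i j : ι) :
    weylGroup.ofIdx P (P.reflectionPerm j i) =
      weylGroup.ofIdx P j * weylGroup.ofIdx P i * weylGroup.ofIdx P j := by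
  refine Subtype.ext (Equiv.weightHom_injective P ?_)
  change Equiv.weightHom P (Equiv.reflection P _) =
    Equiv.weightHom P (Equiv.reflection P j * Equiv.reflection P i * Equiv.reflection P j)
  rw [map_mul, map_mul]
  simp [reflection_reflectionPerm]

/-- The Weyl group is generated by the simple reflections. -/
lemma Base.exists_word [CharZero R] (b : P.Base) [Finite ι] [P.IsCrystallographic] [P.IsReduced]
    (w : P.weylGroup) :
    ∃ l : List ι, (∀ i ∈ l, i ∈ b.support) ∧ (l.map (weylGroup.ofIdx P)).prod = w := by
  have hidx (i : ι) : ∃ l : List ι, (∀ i ∈ l, i ∈ b.support) ∧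
      (l.map (weylGroup.ofIdx P)).prod = weylGroup.ofIdx P i := by
    induction i using b.induction_reflect with
    | h₀ i h =>
      have : weylGroup.ofIdx P (P.reflectionPerm i i) = weylGroup.ofIdx P i := by
        rw [weylGroup_ofIdx_reflectionPerm, weylGroup_ofIdx_mul_self, one_mul]
      rwa [this]
    | h₁ i h => exact ⟨[i], by simpa using h, by simp⟩
    | h₂ i j h hj =>
      obtain ⟨l, hl, hl'⟩ := h
      refine ⟨j :: (l ++ [j]), ?_, ?_⟩
      · simp only [List.mem_cons, List.mem_append]
        aesop
      · simp [weylGroup_ofIdx_reflectionPerm, hl', mul_assoc]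
  obtain ⟨w, hw⟩ := w
  induction hw using weylGroup.induction with
  | mem i => exact hidx i
  | one => exact ⟨[], by simp, rfl⟩
  | mul x y hx hy h h' =>
    obtain ⟨l, hl, hl'⟩ := h
    obtain ⟨m, hm, hm'⟩ := h'
    refine ⟨l ++ m, by simp only [List.mem_append]; aesop, ?_⟩
    rw [List.map_append, List.prod_append, hl', hm']
    rfl

section

variable [CharZero R] [Finite ι] [P.IsCrystallographic] [P.IsReduced] (b : P.Base)

/-- A pointed set of roots which contains one of every pair of opposite roots is the image of the
set of positive roots under an element of the Weyl group which has a word in the simple reflections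
with as many letters as there are positive roots outside the set. The word is built by reflecting in a simple
root which is missing from the set, as long as there is one. -/
lemma IsPointed.exists_word_isPos (n : ℕ) {C : Set ι} (hC : IsPointed P C)
    (htot : ∀ i, i ∈ C ∨ P.reflectionPerm i i ∈ C) (hn : {i | b.IsPos i ∧ i ∉ C}.ncard = n) :
    ∃ l : List ι, (∀ i ∈ l, i ∈ b.support) ∧ l.length = n ∧
      ∀ i, P.weylGroupToPerm (l.map (weylGroup.ofIdx P)).prod i ∈ C ↔ b.IsPos i := by
  induction n generalizing C with
  | zero =>
    rw [Set.ncard_eq_zero] at hn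
    refine ⟨[], by simp, rfl, fun i ↦ ?_⟩
    have hpos : ∀ j, b.IsPos j → j ∈ C := fun j hj ↦ by
      by_contra h
      exact (Set.eq_empty_iff_forall_notMem.mp hn) j ⟨hj, h⟩
    suffices i ∈ C ↔ b.IsPos i by simpa using this
    refine ⟨fun hi ↦ ?_, hpos i⟩
    by_contra h
    exact hC.reflectionPerm_notMem hi (hpos _ ((b.isPos_reflectionPerm_self i).mpr h))
  | succ n ih =>
    obtain ⟨a, ha, haC⟩ : ∃ a ∈ b.support, a ∉ C := by
      by_contra! h
      suffices {i | b.IsPos i ∧ i ∉ C} = ∅ by simp [this] at hn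
      refine Set.eq_empty_iff_forall_notMem.mpr fun i hi ↦ hi.2 ?_
      exact hi.1.induction_on_add h fun i j k hk hi hj ↦ hC.add_mem htot hi (h j hj) hk
    have haC' := (htot a).resolve_left haC
    have hapos := Base.isPos_of_mem_support ha
    have hinv (i : ι) : P.reflectionPerm a (P.reflectionPerm a i) = i := by simp
    have himage : {i | b.IsPos i ∧ i ∉ C} =
        insert a (P.reflectionPerm a '' {i | b.IsPos i ∧ i ∉ P.reflectionPerm a ⁻¹' C}) := by
      ext i
      simp only [Set.mem_ofPred_eq, Set.mem_insert_iff, Set.mem_image, Set.mem_preimage]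
      constructor
      · rintro ⟨hi, hi'⟩
        by_cases hia : i = a
        · exact .inl hia
        · exact .inr ⟨_, ⟨hi.reflectionPerm ha hia, by rwa [hinv]⟩, hinv i⟩
      · rintro (rfl | ⟨j, ⟨hj, hj'⟩, rfl⟩)
        · exact ⟨hapos, haC⟩
        · refine ⟨hj.reflectionPerm ha ?_, hj'⟩
          rintro rfl
          exact hj' haC'
    have hnot : a ∉ P.reflectionPerm a '' {i | b.IsPos i ∧ i ∉ P.reflectionPerm a ⁻¹' C} := by
      rintro ⟨j, ⟨hj, hj'⟩, h⟩
      have : j = P.reflectionPerm a a := by rw [← hinv j, h]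
      rw [this, b.isPos_reflectionPerm_self] at hj
      exact hj hapos
    rw [himage, Set.ncard_insert_of_notMem hnot, Nat.add_right_cancel_iff,
      Set.ncard_image_of_injective _ (P.reflectionPerm a).injective] at hn
    obtain ⟨l, hl, hlen, h⟩ := ih (hC.preimage_reflectionPerm a) (fun i ↦ by
      simpa only [Set.mem_preimage, reflectionPerm_reflectionPerm_self] using htot _) hn
    refine ⟨a :: l, by simp; exact ⟨ha, hl⟩, by simp [hlen], fun i ↦ ?_⟩
    rw [← h, List.map_cons, List.prod_cons, map_mul]
    rfl

/-- A word in the simple reflections has at least as many letters as its product `v` has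
inversions, here the positive roots sent to negative ones by `v⁻¹`. -/
lemma Base.ncard_inversions_le (l : List ι) (hl : ∀ i ∈ l, i ∈ b.support) :
    {i | b.IsPos i ∧ ¬ b.IsPos
      (P.weylGroupToPerm ((l.map (weylGroup.ofIdx P)).prod)⁻¹ i)}.ncard ≤ l.length := by
  induction l with
  | nil => simp
  | cons a l ih =>
    have ha : a ∈ b.support := hl a (by simp)
    specialize ih fun i hi ↦ hl i (by simp [hi])
    have hinv : (weylGroup.ofIdx P a)⁻¹ = weylGroup.ofIdx P a :=
      inv_eq_of_mul_eq_one_left (weylGroup_ofIdx_mul_self P a)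
    rw [List.map_cons, List.prod_cons, mul_inv_rev, hinv, map_mul, List.length_cons]
    refine le_trans ?_ (Nat.add_le_add_right ih 1)
    set v := ((l.map (weylGroup.ofIdx P)).prod)⁻¹
    rw [← Set.ncard_image_of_injective {i | b.IsPos i ∧ ¬ b.IsPos (P.weylGroupToPerm v i)}
      (P.reflectionPerm a).injective]
    refine le_trans (Set.ncard_le_ncard ?_ (Set.toFinite _)) (Set.ncard_insert_le a _)
    rintro i ⟨hi, hi'⟩
    by_cases hia : i = a
    · exact .inl hia
    · exact .inr ⟨P.reflectionPerm a i, ⟨hi.reflectionPerm ha hia, hi'⟩, by simp⟩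

/-- If `f` is a linear functional, then reflections in simple roots on which `f` vanishes permute
the positive roots on which `f` does not vanish. -/
lemma Base.isPos_of_mem_closure (f : M →ₗ[R] R) {u : P.weylGroup}
    (hu : u ∈ Subgroup.closure {s | ∃ i ∈ b.support, f (P.root i) = 0 ∧
      s = weylGroup.ofIdx P i}) {i : ι} (hi : b.IsPos i) (hfi : f (P.root i) ≠ 0) :
    b.IsPos (P.weylGroupToPerm u i) ∧ f (P.root (P.weylGroupToPerm u i)) ≠ 0 := by
  have key (a : ι) (ha : a ∈ b.support) (ha0 : f (P.root a) = 0) (i : ι) (hi : b.IsPos i)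
      (hfi : f (P.root i) ≠ 0) :
      b.IsPos (P.weylGroupToPerm (weylGroup.ofIdx P a) i) ∧
        f (P.root (P.weylGroupToPerm (weylGroup.ofIdx P a) i)) ≠ 0 := by
    rw [weylGroupToPerm_ofIdx]
    refine ⟨hi.reflectionPerm ha (by rintro rfl; exact hfi ha0), ?_⟩
    simpa [root_reflectionPerm, reflection_apply, ha0] using hfi
  induction hu using Subgroup.closure_induction'' generalizing i with
  | one => simpa using ⟨hi, hfi⟩
  | mem s hs =>
    obtain ⟨a, ha, ha0, rfl⟩ := hs
    exact key a ha ha0 i hi hfi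
  | inv_mem s hs =>
    obtain ⟨a, ha, ha0, rfl⟩ := hs
    rw [inv_eq_of_mul_eq_one_left (weylGroup_ofIdx_mul_self P a)]
    exact key a ha ha0 i hi hfi
  | mul x y hx hy h h' =>
    rw [map_mul]
    obtain ⟨h1, h2⟩ := h' hi hfi
    exact h h1 h2

end

/-! ### Pointedness of the set attached to a stable set of roots -/

section

variable [CharZero R]

/-- If two sums of roots agree and do not vanish, then some summand of the first has an acute angle
with some summand of the second, by positivity of the invariant form. -/
lemma exists_pairingIn_pos [Finite ι] [P.IsCrystallographic] {s d : Multiset ι}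
    (h : (s.map P.root).sum = (d.map P.root).sum) (h0 : (d.map P.root).sum ≠ 0) :
    ∃ i ∈ s, ∃ j ∈ d, 0 < P.pairingIn ℤ i j := by
  have := Fintype.ofFinite ι
  set B := (P.posRootForm ℤ).posForm
  have hcoe (m : Multiset ι) :
      (((m.map (P.rootSpanMem ℤ)).sum : P.rootSpan ℤ) : M) = (m.map P.root).sum := by
    induction m using Multiset.induction with
    | empty => simp
    | cons a m ih => simp [ih]
  have heq : (s.map (P.rootSpanMem ℤ)).sum = (d.map (P.rootSpanMem ℤ)).sum :=
    Subtype.ext (by rw [hcoe, hcoe, h])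
  have hpos : 0 < B (s.map (P.rootSpanMem ℤ)).sum (d.map (P.rootSpanMem ℤ)).sum := by
    rw [heq]
    refine P.posRootForm_posForm_pos_of_ne_zero ℤ fun h ↦ h0 ?_
    rw [← hcoe, h, ZeroMemClass.coe_zero]
  by_contra! hle
  refine hpos.not_ge ?_
  have aux (i : ι) (hi : i ∈ s) (m : Multiset ι) (hm : ∀ j ∈ m, j ∈ d) :
      B (P.rootSpanMem ℤ i) (m.map (P.rootSpanMem ℤ)).sum ≤ 0 := by
    induction m using Multiset.induction with
    | empty => simp
    | cons a m ih =>
      rw [Multiset.map_cons, Multiset.sum_cons, map_add]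
      refine add_nonpos ?_ (ih fun j hj ↦ hm j (Multiset.mem_cons_of_mem hj))
      exact ((P.posRootForm ℤ).posForm_apply_root_root_le_zero_iff i a).mpr
        (hle i hi a (hm a (Multiset.mem_cons_self a m)))
  have aux' (m : Multiset ι) (hm : ∀ j ∈ m, j ∈ s) :
      B (m.map (P.rootSpanMem ℤ)).sum (d.map (P.rootSpanMem ℤ)).sum ≤ 0 := by
    induction m using Multiset.induction with
    | empty => simp
    | cons a m ih =>
      rw [Multiset.map_cons, Multiset.sum_cons, map_add, LinearMap.add_apply]
      exact add_nonpos (aux a (hm a (Multiset.mem_cons_self a m)) d fun _ h ↦ h)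
        (ih fun j hj ↦ hm j (Multiset.mem_cons_of_mem hj))
  exact aux' s fun _ h ↦ h

/-- The positive roots are pointed, as the height extends to a linear functional. -/
lemma Base.isPointed_isPos [P.IsRootSystem] (b : P.Base) : IsPointed P {i | b.IsPos i} := by
  let ht : M →ₗ[R] R := b.toWeightBasis.constr R fun _ ↦ (1 : R)
  have hs (j : ι) (hj : j ∈ b.support) : ht (P.root j) = 1 := by
    have := b.toWeightBasis.constr_basis R (fun _ ↦ (1 : R)) ⟨j, hj⟩
    rwa [b.toWeightBasis_apply] at this
  have hht (i : ι) : ht (P.root i) = b.height i := by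
    obtain ⟨f, -, -, hf⟩ := b.exists_root_eq_sum_int i
    rw [height_eq_sum hf, hf, map_sum, Int.cast_sum]
    refine Finset.sum_congr rfl fun j hj ↦ ?_
    rw [map_zsmul, hs j hj, zsmul_one]
  have hsum (m : Multiset ι) : ht (m.map P.root).sum = ((m.map b.height).sum : ℤ) := by
    induction m using Multiset.induction with
    | empty => simp
    | cons a m ih => simp [ih, hht]
  intro m hm h
  have h0 : (m.map b.height).sum = 0 := by
    have := hsum m
    rw [h, map_zero] at this
    exact_mod_cast this.symm
  have hpos (m : Multiset ι) (hm : ∀ i ∈ m, b.IsPos i) : (m.card : ℤ) ≤ (m.map b.height).sum := by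
    induction m using Multiset.induction with
    | empty => simp
    | cons a m ih =>
      have h1 := ih fun i hi ↦ hm i (Multiset.mem_cons_of_mem hi)
      have h2 : 0 < b.height a := hm a (Multiset.mem_cons_self a m)
      rw [Multiset.card_cons, Multiset.map_cons, Multiset.sum_cons]
      push_cast
      lia
  have := hpos m hm
  rw [← Multiset.card_eq_zero]
  lia

variable [Finite ι] [P.IsCrystallographic] [P.IsRootSystem] (b : P.Base) (f : M →ₗ[R] R)

/-- The positive roots of degree zero, where the degree of a root is its value under the linear
functional `f`. -/
def Base.posDegreeZero : Set ι := {i | b.IsPos i ∧ f (P.root i) = 0}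

variable {b f} {c : R} {S : Set ι}

/-- The cancellation at the heart of the argument. A sum of roots from `S` and positive roots of
degree zero cannot equal a sum of degree `c` roots outside `S`. Otherwise there is an acute angle
between a summand `i` on the left and a summand `j` on the right, and `i - j` is a root: depending
on the kind of `i` and the sign of `i - j`, this contradicts the stability of `S`, or gives a
shorter relation. -/
lemma Base.eq_zero_of_sum_eq (hc : c ≠ 0) (hSc : ∀ i ∈ S, f (P.root i) = c)
    (hS : ∀ i ∈ S, ∀ j ∈ b.posDegreeZero f, ∀ k, P.root k = P.root i + P.root j → k ∈ S)
    (n : ℕ) (r : ℕ) (s p d : Multiset ι) (hs : ∀ i ∈ s, i ∈ S) (hp : ∀ i ∈ p, i ∈ b.posDegreeZero f)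
    (hd : ∀ i ∈ d, f (P.root i) = c ∧ i ∉ S) (hsn : s.card = n) (hdn : d.card = n)
    (hpr : p.card = r)
    (h : (s.map P.root).sum + (p.map P.root).sum = (d.map P.root).sum) : n = 0 ∧ p = 0 := by
  classical
  have := Fintype.ofFinite ι
  induction n generalizing r s p d with
  | zero =>
    rw [Multiset.card_eq_zero] at hsn hdn
    subst hsn hdn
    exact ⟨rfl, b.isPointed_isPos p (fun i hi ↦ (hp i hi).1) (by simpa using h)⟩
  | succ n ih =>
    exfalso
    induction r using Nat.strong_induction_on generalizing s p d with
    | h r ihr =>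
    have hdeg (m : Multiset ι) (hm : ∀ i ∈ m, f (P.root i) = c) :
        f (m.map P.root).sum = m.card • c := by
      induction m using Multiset.induction with
      | empty => simp
      | cons a m ih =>
        rw [Multiset.map_cons, Multiset.sum_cons, map_add, hm a (Multiset.mem_cons_self a m),
          ih fun i hi ↦ hm i (Multiset.mem_cons_of_mem hi), Multiset.card_cons, succ_nsmul']
    have h0 : (d.map P.root).sum ≠ 0 := by
      intro h0
      have := hdeg d fun i hi ↦ (hd i hi).1
      rw [h0, map_zero, hdn, ← Nat.cast_smul_eq_nsmul R, smul_eq_mul, eq_comm, mul_eq_zero] at this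
      exact this.elim (Nat.cast_ne_zero.mpr n.succ_ne_zero) hc
    obtain ⟨i, hi, j, hj, hij⟩ := exists_pairingIn_pos (P := P) (s := s + p) (by simpa using h) h0
    obtain ⟨d, rfl⟩ := Multiset.exists_cons_of_mem hj
    obtain ⟨hjc, hjS⟩ := hd j (Multiset.mem_cons_self j d)
    have hd' : ∀ i ∈ d, f (P.root i) = c ∧ i ∉ S := fun i hi ↦ hd i (Multiset.mem_cons_of_mem hi)
    rw [Multiset.card_cons, Nat.add_right_cancel_iff] at hdn
    rcases Multiset.mem_add.mp hi with hi | hi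
    · -- `i ∈ S` and `j ∉ S` have the same degree, so that `k = i - j` has degree zero
      have hne : i ≠ j := by
        rintro rfl
        exact hjS (hs i hi)
      obtain ⟨k, hk⟩ := P.root_sub_root_mem_of_pairingIn_pos hij hne
      have hk0 : f (P.root k) = 0 := by rw [hk, map_sub, hSc i (hs i hi), hjc, sub_self]
      by_cases hkpos : b.IsPos k
      · obtain ⟨s, rfl⟩ := Multiset.exists_cons_of_mem hi
        rw [Multiset.card_cons, Nat.add_right_cancel_iff] at hsn
        have := ih (r + 1) s (k ::ₘ p) d (fun i hi ↦ hs i (Multiset.mem_cons_of_mem hi))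
          (by
            intro i hi
            rcases Multiset.mem_cons.mp hi with rfl | hi
            · exact ⟨hkpos, hk0⟩
            · exact hp i hi) hd' hsn hdn (by simp [hpr]) (by
            simp only [Multiset.map_cons, Multiset.sum_cons, hk] at h ⊢
            rw [← sub_eq_zero] at h ⊢
            rw [← h]
            abel)
        simp at this
      · refine hjS (hS i (hs i hi) (P.reflectionPerm k k)
          ⟨(b.isPos_reflectionPerm_self k).mpr hkpos, ?_⟩ j ?_)
        · rw [root_reflectionPerm_self, map_neg, hk0, neg_zero]
        · rw [root_reflectionPerm_self, hk]
          abel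
    · -- `i` has degree zero, so that `k = j - i` may replace `j` on the right
      have hi0 := hp i hi
      have hne : i ≠ j := by
        rintro rfl
        exact hc (hjc.symm.trans hi0.2)
      obtain ⟨k, hk⟩ := P.root_sub_root_mem_of_pairingIn_pos
        ((zero_lt_pairingIn_iff (P.posRootForm ℤ) i j).mp hij) hne.symm
      obtain ⟨p, rfl⟩ := Multiset.exists_cons_of_mem hi
      rw [Multiset.card_cons] at hpr
      refine ihr p.card (by lia) s p (k ::ₘ d) hs
        (fun i hi ↦ hp i (Multiset.mem_cons_of_mem hi)) ?_ hsn (by simp [hdn]) rfl ?_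
      · intro a ha
        rcases Multiset.mem_cons.mp ha with rfl | ha
        · refine ⟨by rw [hk, map_sub, hjc, hi0.2, sub_zero], fun haS ↦ hjS ?_⟩
          exact hS a haS i hi0 j (by rw [hk]; abel)
        · exact hd' a ha
      · simp only [Multiset.map_cons, Multiset.sum_cons, hk] at h ⊢
        rw [← sub_eq_zero] at h ⊢
        rw [← h]
        abel

/-- If `S` is a set of roots of degree `c` which is stable under adding positive roots of degree
zero, then the positive roots of degree zero, the members of `S`, and the negatives of the other
roots of degree `c` form a pointed set. -/
lemma Base.isPointed_of_stable (hc : c ≠ 0) (hSc : ∀ i ∈ S, f (P.root i) = c)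
    (hS : ∀ i ∈ S, ∀ j ∈ b.posDegreeZero f, ∀ k, P.root k = P.root i + P.root j → k ∈ S) :
    IsPointed P (b.posDegreeZero f ∪ S ∪
      {i | f (P.root i) = -c ∧ P.reflectionPerm i i ∉ S}) := by
  have split (m : Multiset ι) (hm : ∀ i ∈ m, i ∈ b.posDegreeZero f ∪ S ∪
      {i | f (P.root i) = -c ∧ P.reflectionPerm i i ∉ S}) :
      ∃ s p d : Multiset ι, (∀ i ∈ s, i ∈ S) ∧ (∀ i ∈ p, i ∈ b.posDegreeZero f) ∧
        (∀ i ∈ d, f (P.root i) = c ∧ i ∉ S) ∧ m.card = s.card + p.card + d.card ∧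
        (m.map P.root).sum = (s.map P.root).sum + (p.map P.root).sum - (d.map P.root).sum ∧
        f (m.map P.root).sum = (s.card - d.card : R) * c := by
    induction m using Multiset.induction with
    | empty => exact ⟨0, 0, 0, by simp⟩
    | cons a m ih =>
      obtain ⟨s, p, d, hs, hp, hd, hcard, hsum, hf⟩ :=
        ih fun i hi ↦ hm i (Multiset.mem_cons_of_mem hi)
      have hcons {Q : ι → Prop} {t : Multiset ι} {i : ι} (hi : Q i) (ht : ∀ i ∈ t, Q i) :
          ∀ j ∈ i ::ₘ t, Q j := by
        simpa using ⟨hi, ht⟩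
      rcases hm a (Multiset.mem_cons_self a m) with (ha | ha) | ha
      · refine ⟨s, a ::ₘ p, d, hs, hcons ha hp, hd, by simp; lia, ?_, ?_⟩
        · simp only [Multiset.map_cons, Multiset.sum_cons, hsum]
          abel
        · rw [Multiset.map_cons, Multiset.sum_cons, map_add, ha.2, hf, zero_add]
      · refine ⟨a ::ₘ s, p, d, hcons ha hs, hp, hd, by simp; lia, ?_, ?_⟩
        · simp only [Multiset.map_cons, Multiset.sum_cons, hsum]
          abel
        · rw [Multiset.map_cons, Multiset.sum_cons, map_add, hSc a ha, hf, Multiset.card_cons]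
          push_cast
          ring
      · refine ⟨s, p, P.reflectionPerm a a ::ₘ d, hs, hp, hcons ⟨?_, ha.2⟩ hd,
          by simp; lia, ?_, ?_⟩
        · rw [root_reflectionPerm_self, map_neg, ha.1, neg_neg]
        · simp only [Multiset.map_cons, Multiset.sum_cons, hsum, root_reflectionPerm_self]
          abel
        · rw [Multiset.map_cons, Multiset.sum_cons, map_add, ha.1, hf, Multiset.card_cons]
          push_cast
          ring
  intro m hm h0
  obtain ⟨s, p, d, hs, hp, hd, hcard, hsum, hf⟩ := split m hm
  rw [h0, map_zero, eq_comm, mul_eq_zero, or_iff_left hc, sub_eq_zero, Nat.cast_inj] at hf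
  rw [h0, eq_comm, sub_eq_zero] at hsum
  obtain ⟨h1, rfl⟩ := eq_zero_of_sum_eq hc hSc hS s.card _ s p d hs hp hd rfl hf.symm rfl hsum
  rw [← Multiset.card_eq_zero, hcard, ← hf, h1, Multiset.card_zero]

/-- Let `S` be a set of roots of degree `c ≠ 0` which is stable under adding positive roots of
degree zero. Then there is `w` in the Weyl group for which a root `w i` of degree `c` lies in `S` if
and only if `i` is positive, and `w` has a word in the simple reflections which is no longer than any word for any `u * w`, where `u`
is a product of simple reflections of degree zero. -/
theorem Base.exists_weylGroup_of_stable [P.IsReduced] (hc : c ≠ 0)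
    (hSc : ∀ i ∈ S, f (P.root i) = c)
    (hS : ∀ i ∈ S, ∀ j ∈ b.posDegreeZero f, ∀ k, P.root k = P.root i + P.root j → k ∈ S) :
    ∃ w : P.weylGroup,
      (∀ i, f (P.root (P.weylGroupToPerm w i)) = c → (P.weylGroupToPerm w i ∈ S ↔ b.IsPos i)) ∧
      ∃ l : List ι, (∀ i ∈ l, i ∈ b.support) ∧ (l.map (weylGroup.ofIdx P)).prod = w ∧
        ∀ u ∈ Subgroup.closure {s | ∃ i ∈ b.support, f (P.root i) = 0 ∧ s = weylGroup.ofIdx P i},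
        ∀ l' : List ι, (∀ i ∈ l', i ∈ b.support) → (l'.map (weylGroup.ofIdx P)).prod = u * w →
          l.length ≤ l'.length := by
  obtain ⟨C, hAC, hC, htot⟩ := (isPointed_of_stable hc hSc hS).exists_total
  obtain ⟨l, hl, hlen, hlC⟩ := hC.exists_word_isPos b _ htot rfl
  refine ⟨_, fun i hi ↦ ?_, l, hl, rfl, fun u hu l' hl' hprod ↦ ?_⟩
  · rw [← hlC]
    refine ⟨fun h ↦ hAC (.inl (.inr h)), fun h ↦ ?_⟩
    by_contra hiS
    refine hC.reflectionPerm_notMem h (hAC (.inr ⟨?_, ?_⟩))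
    · rw [root_reflectionPerm_self, map_neg, hi]
    · have (j : ι) : P.reflectionPerm (P.reflectionPerm j j) (P.reflectionPerm j j) = j := by
        apply P.root.injective
        rw [root_reflectionPerm_self, root_reflectionPerm_self, neg_neg]
      rwa [this]
  · have hle := b.ncard_inversions_le l' hl'
    rw [hprod] at hle
    refine le_trans ?_ hle
    rw [hlen, ← Set.ncard_image_of_injective {i | b.IsPos i ∧ i ∉ C} (P.weylGroupToPerm u).injective]
    refine Set.ncard_le_ncard ?_ (Set.toFinite _)
    rintro _ ⟨i, ⟨hi, hiC⟩, rfl⟩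
    have hi0 : f (P.root i) ≠ 0 := fun h ↦ hiC (hAC (.inl (.inl ⟨hi, h⟩)))
    refine ⟨(b.isPos_of_mem_closure f hu hi hi0).1, ?_⟩
    rw [← hlC, mul_inv_rev, map_mul, map_inv, map_inv, Equiv.Perm.mul_apply]
    simpa using hiC

end

end RootPairing

/-! ### The exponential of an endomorphism -/

namespace NilpotentGrading

section Exponential

variable {V W : Type*} [AddCommGroup V] [Module ℂ V] [FiniteDimensional ℂ V]
  [AddCommGroup W] [Module ℂ W] [FiniteDimensional ℂ W]

attribute [local instance] Matrix.linftyOpNormedRing Matrix.linftyOpNormedAlgebra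

/-- The exponential series converges coordinatewise. As the coordinates are arbitrary linear
functionals, this determines `endExp` without reference to a basis. -/
lemma hasSum_endExp (f : V →ₗ[ℂ] V) (v : V) (ξ : V →ₗ[ℂ] ℂ) :
    HasSum (fun n : ℕ ↦ (n.factorial : ℂ)⁻¹ * ξ ((f ^ n) v)) (ξ (endExp f v)) := by
  set e := LinearMap.toMatrixAlgEquiv (finBasis ℂ V)
  let L : Matrix (Fin (finrank ℂ V)) (Fin (finrank ℂ V)) ℂ →ₗ[ℂ] ℂ :=
    ξ ∘ₗ LinearMap.applyₗ v ∘ₗ e.symm.toLinearMap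
  have h := (NormedSpace.exp_series_hasSum_exp' (𝕂 := ℂ) (e f)).map L
    L.continuous_of_finiteDimensional
  convert! h using 1
  ext n
  simp [L, ← map_pow]

lemma hasDerivAt_endExp (f : V →ₗ[ℂ] V) (v : V) (ξ : V →ₗ[ℂ] ℂ) :
    HasDerivAt (fun t : ℂ ↦ ξ (endExp (t • f) v)) (ξ (f v)) 0 := by
  set e := LinearMap.toMatrixAlgEquiv (finBasis ℂ V) with he
  let L : Matrix (Fin (finrank ℂ V)) (Fin (finrank ℂ V)) ℂ →ₗ[ℂ] ℂ :=
    ξ ∘ₗ LinearMap.applyₗ v ∘ₗ e.symm.toLinearMap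
  have h := (LinearMap.toContinuousLinearMap L).hasFDerivAt.comp_hasDerivAt (0 : ℂ)
    (hasDerivAt_exp_smul_const (𝕂 := ℂ) (e f) 0)
  convert! h using 1
  · ext t
    simp only [endExp, ← he, map_smul]
    rfl
  · have : ξ (f v) = L (e f) := by simp [L]
    simp only [zero_smul, NormedSpace.exp_zero, one_mul, this]
    rfl

lemma endExp_ext {f : V →ₗ[ℂ] V} {v w : V}
    (h : ∀ ξ : V →ₗ[ℂ] ℂ, HasSum (fun n : ℕ ↦ (n.factorial : ℂ)⁻¹ * ξ ((f ^ n) v)) (ξ w)) :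
    endExp f v = w :=
  (Module.forall_dual_apply_eq_zero_iff ℂ _).mp (fun ξ ↦ by
    rw [map_sub, (hasSum_endExp f v ξ).unique (h ξ), sub_self]) |> sub_eq_zero.mp

/-- The exponential is natural: it commutes with linear maps which intertwine endomorphisms. -/
lemma map_endExp {f : V →ₗ[ℂ] V} {g : W →ₗ[ℂ] W} (φ : V →ₗ[ℂ] W)
    (h : ∀ v, φ (f v) = g (φ v)) (v : V) : φ (endExp f v) = endExp g (φ v) := by
  refine (endExp_ext fun ξ ↦ ?_).symm
  convert! hasSum_endExp f v (ξ ∘ₗ φ) using 4 with n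
  have (n : ℕ) : (g ^ n) (φ v) = φ ((f ^ n) v) := by
    induction n with
    | zero => simp
    | succ n ih => rw [pow_succ', pow_succ', Module.End.mul_apply, ih, Module.End.mul_apply, h]
  exact congrArg ξ (this n)

lemma endExp_add {f g : V →ₗ[ℂ] V} (h : Commute f g) : endExp (f + g) = endExp f ∘ₗ endExp g := by
  set e := LinearMap.toMatrixAlgEquiv (finBasis ℂ V) with he
  have h' : Commute (e f) (e g) := h.map e
  change e.symm (NormedSpace.exp (e (f + g))) =
    e.symm (NormedSpace.exp (e f)) * e.symm (NormedSpace.exp (e g))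
  rw [map_add, Matrix.exp_add_of_commute _ _ h', map_mul]

lemma endExp_zero : endExp (0 : V →ₗ[ℂ] V) = LinearMap.id := by
  simp only [endExp, map_zero, NormedSpace.exp_zero, map_one]
  rfl

/-- The exponential as an automorphism. -/
noncomputable def endExpEquiv (f : V →ₗ[ℂ] V) : V ≃ₗ[ℂ] V :=
  LinearEquiv.ofLinearMap (endExp f) (endExp (-f))
    (by rw [← endExp_add (Commute.neg_right (Commute.refl f)), add_neg_cancel, endExp_zero])
    (by rw [← endExp_add (Commute.neg_left (Commute.refl f)), neg_add_cancel, endExp_zero])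

lemma endExpEquiv_apply (f : V →ₗ[ℂ] V) (v : V) : endExpEquiv f v = endExp f v := rfl

/-- A subspace which is stable under a one-parameter group is stable under its generator. -/
lemma mem_of_forall_endExp_smul_mem {U : Submodule ℂ V} {f : V →ₗ[ℂ] V}
    (h : ∀ t : ℂ, ∀ u ∈ U, endExp (t • f) u ∈ U) {u : V} (hu : u ∈ U) : f u ∈ U := by
  by_contra hfu
  obtain ⟨ξ, hξ, hU⟩ := Submodule.exists_le_ker_of_notMem hfu
  have h0 : (fun t : ℂ ↦ ξ (endExp (t • f) u)) = fun _ ↦ 0 :=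
    funext fun t ↦ hU (h t u hu)
  have := hasDerivAt_endExp f u ξ
  rw [h0] at this
  exact hξ (this.unique (hasDerivAt_const 0 0))

/-- On a vector killed by the cube of an endomorphism the exponential series stops after three
terms. -/
lemma endExp_apply_of_pow_three {f : V →ₗ[ℂ] V} {v : V} (h : f (f (f v)) = 0) :
    endExp f v = v + f v + (2⁻¹ : ℂ) • f (f v) := by
  refine endExp_ext fun ξ ↦ ?_
  have hz (n : ℕ) : (f ^ (n + 3)) v = 0 := by
    rw [pow_add, Module.End.mul_apply]
    simp [pow_succ, h]
  have := hasSum_sum_of_ne_finset_zero (s := Finset.range 3)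
    (f := fun n : ℕ ↦ (n.factorial : ℂ)⁻¹ * ξ ((f ^ n) v)) (L := .unconditional _) (by
      intro n hn
      obtain ⟨k, rfl⟩ := Nat.exists_eq_add_of_le' (not_lt.mp (Finset.mem_range.not.mp hn))
      rw [hz, map_zero, mul_zero])
  convert! this using 1
  simp [Finset.sum_range_succ, pow_succ, Nat.factorial]

end Exponential

section Automorphisms

variable {𝔤 : Type*} [LieRing 𝔤] [LieAlgebra ℂ 𝔤] [FiniteDimensional ℂ 𝔤]

open scoped TensorProduct in
/-- The exponential of a derivation is an automorphism: the bracket `𝔤 ⊗ 𝔤 → 𝔤` intertwines the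
derivation `D` with the sum of the commuting endomorphisms `D ⊗ 1` and `1 ⊗ D`. -/
lemma endExp_ad_lie (z a c : 𝔤) :
    endExp (ad ℂ 𝔤 z) ⁅a, c⁆ = ⁅endExp (ad ℂ 𝔤 z) a, endExp (ad ℂ 𝔤 z) c⁆ := by
  set D : 𝔤 →ₗ[ℂ] 𝔤 := ad ℂ 𝔤 z
  let φ : 𝔤 ⊗[ℂ] 𝔤 →ₗ[ℂ] 𝔤 := TensorProduct.lift (toEnd ℂ 𝔤 𝔤 : 𝔤 →ₗ[ℂ] 𝔤 →ₗ[ℂ] 𝔤)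
  have hφ (x y : 𝔤) : φ (x ⊗ₜ y) = ⁅x, y⁆ := rfl
  have hcomm : Commute (D.rTensor 𝔤) (D.lTensor 𝔤) := by
    change D.rTensor 𝔤 ∘ₗ D.lTensor 𝔤 = D.lTensor 𝔤 ∘ₗ D.rTensor 𝔤
    rw [LinearMap.rTensor_comp_lTensor, LinearMap.lTensor_comp_rTensor]
  have hD (v : 𝔤 ⊗[ℂ] 𝔤) : φ ((D.rTensor 𝔤 + D.lTensor 𝔤) v) = D (φ v) := by
    induction v with
    | zero => simp
    | add x y hx hy => rw [map_add, map_add, map_add, hx, hy, map_add]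
    | tmul x y => simp [hφ, D]
  have h1 := map_endExp (TensorProduct.mk ℂ 𝔤 𝔤 a) (f := D) (g := D.lTensor 𝔤) (fun v ↦ by simp) c
  have h2 := map_endExp ((TensorProduct.mk ℂ 𝔤 𝔤).flip (endExp D c)) (f := D) (g := D.rTensor 𝔤)
    (fun v ↦ by simp) a
  simp only [LinearMap.flip_apply, TensorProduct.mk_apply] at h1 h2
  rw [← hφ, ← map_endExp φ hD, endExp_add hcomm, LinearMap.comp_apply, ← h1, ← h2, hφ]

lemma map_lie_of_mem_adGroup {𝔥 : Submodule ℂ 𝔤} {n : 𝔤 ≃ₗ[ℂ] 𝔤} (hn : n ∈ adGroup 𝔥) (a c : 𝔤) :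
    n ⁅a, c⁆ = ⁅n a, n c⁆ := by
  induction hn using Subgroup.closure_induction generalizing a c with
  | mem g hg =>
    obtain ⟨z, -, hz⟩ := hg
    have (x : 𝔤) : g x = endExp (ad ℂ 𝔤 z) x := LinearMap.congr_fun hz x
    simp only [this, endExp_ad_lie]
  | one => rfl
  | mul x y hx hy h h' => rw [LinearEquiv.mul_apply, h', h]; rfl
  | inv x hx h =>
    apply x.injective
    rw [h]
    have (v : 𝔤) : x (x⁻¹ v) = v := x.apply_symm_apply v
    simp only [this]

lemma endExpEquiv_mem_adGroup {𝔥 : Submodule ℂ 𝔤} {z : 𝔤} (hz : z ∈ 𝔥) :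
    endExpEquiv (ad ℂ 𝔤 z) ∈ adGroup 𝔥 :=
  Subgroup.subset_closure ⟨z, hz, rfl⟩

end Automorphisms

end NilpotentGrading

/-! ### Root spaces -/

namespace NilpotentGrading

variable {𝔤 : Type*} [LieRing 𝔤] [LieAlgebra ℂ 𝔤] [FiniteDimensional ℂ 𝔤] [IsKilling ℂ 𝔤]
  {𝔱 : LieSubalgebra ℂ 𝔤} [𝔱.IsCartanSubalgebra]

lemma lie_eq_smul_of_mem {i : 𝔱.root} {x : 𝔤} (hx : x ∈ rootSpace 𝔱 (i.1 : 𝔱 → ℂ)) (t : 𝔱) :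
    ⁅(t : 𝔤), x⁆ = (rootSystem 𝔱).root i t • x :=
  lie_eq_smul_of_mem_rootSpace hx t

lemma mem_rootSpace_of_lie {i : 𝔱.root} {x : 𝔤}
    (h : ∀ t : 𝔱, ⁅(t : 𝔤), x⁆ = (rootSystem 𝔱).root i t • x) :
    x ∈ rootSpace 𝔱 (i.1 : 𝔱 → ℂ) :=
  weightSpace_le_genWeightSpace 𝔤 _ ((mem_weightSpace _ _).mpr h)

lemma rootSpace_le_or_disjoint (i : 𝔱.root) (U : Submodule ℂ 𝔤) :
    (rootSpace 𝔱 (i.1 : 𝔱 → ℂ)).toSubmodule ≤ U ∨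
      Disjoint (rootSpace 𝔱 (i.1 : 𝔱 → ℂ)).toSubmodule U := by
  have ha := Submodule.isAtom_iff_finrank_eq_one.mpr
    (finrank_rootSpace_eq_one i.1 (LieSubalgebra.isNonZero_coe_root i))
  by_cases h : (rootSpace 𝔱 (i.1 : 𝔱 → ℂ)).toSubmodule ≤ U
  · exact .inl h
  · exact .inr (ha.not_le_iff_disjoint.mp h)

/-- A root space lies in a subspace as soon as one of its nonzero vectors does. -/
lemma rootSpace_le_of_mem {i : 𝔱.root} {U : Submodule ℂ 𝔤} {x : 𝔤}
    (hx : x ∈ rootSpace 𝔱 (i.1 : 𝔱 → ℂ)) (hx0 : x ≠ 0) (hU : x ∈ U) :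
    (rootSpace 𝔱 (i.1 : 𝔱 → ℂ)).toSubmodule ≤ U :=
  (rootSpace_le_or_disjoint i U).resolve_right fun h ↦ hx0 (Submodule.disjoint_def.mp h x hx hU)

lemma rootSpace_le_gradedPiece_iff {i : 𝔱.root} {h : 𝔱} {j : ℤ} :
    (rootSpace 𝔱 (i.1 : 𝔱 → ℂ)).toSubmodule ≤ gradedPiece (h : 𝔤) j ↔
      (rootSystem 𝔱).root i h = j := by
  constructor
  · intro hle
    obtain ⟨x, hx, hx0⟩ := i.1.exists_ne_zero
    have h1 : ⁅(h : 𝔤), x⁆ = (j : ℂ) • x := End.mem_eigenspace_iff.mp (hle hx)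
    rw [lie_eq_smul_of_mem hx] at h1
    exact smul_left_injective ℂ hx0 h1
  · intro hij x hx
    refine End.mem_eigenspace_iff.mpr ?_
    rw [ad_apply, lie_eq_smul_of_mem hx, hij]

/-- The bracket of two root spaces does not vanish if the sum of the roots is a root: in the root
string through `β` in direction `α`, the operator `e` moves the vector below the top. -/
lemma exists_lie_ne_zero {i j k : 𝔱.root}
    (hk : (rootSystem 𝔱).root k = (rootSystem 𝔱).root i + (rootSystem 𝔱).root j) :
    ∃ e ∈ rootSpace 𝔱 (j.1 : 𝔱 → ℂ), ∃ v ∈ rootSpace 𝔱 (i.1 : 𝔱 → ℂ),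
      ⁅e, v⁆ ≠ 0 ∧ ⁅e, v⁆ ∈ rootSpace 𝔱 (k.1 : 𝔱 → ℂ) := by
  set α := j.1
  set β := i.1
  have hα : α.IsNonZero := LieSubalgebra.isNonZero_coe_root j
  have hkf : (k.1 : 𝔱 → ℂ) = α + β := by
    ext t
    exact (LinearMap.congr_fun hk t).trans (add_comm _ _)
  have hT : 1 ≤ chainTopCoeff α β := by
    have := ((rootSpace_zsmul_add_ne_bot_iff α β hα 1).mp (by
      rw [one_smul, ← hkf]
      exact k.1.genWeightSpace_ne_bot)).1
    exact_mod_cast this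
  -- `v` will be `f ^ (s + 1)` applied to a vector `x` of the top root space of the string
  obtain ⟨s, hs⟩ := Nat.exists_eq_add_of_le' hT
  obtain ⟨x, hx, x_ne0⟩ := (chainTop α β).exists_ne_zero
  obtain ⟨h, e, f, isSl2, he, hf⟩ := exists_isSl2Triple_of_weight_isNonZero hα
  obtain rfl := isSl2.h_eq_coroot hα he hf
  have prim : isSl2.HasPrimitiveVectorWith x (chainLength α β : ℂ) :=
    have := lie_mem_genWeightSpace_of_mem_genWeightSpace he hx
    ⟨x_ne0, (chainLength_smul _ _ hx).symm, by rwa [genWeightSpace_add_chainTop _ _ hα] at this⟩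
  have hlen := chainTopCoeff_le_chainLength α β
  have hmem := toEnd_pow_apply_mem hf hx (s + 1)
  have hv : ((toEnd ℂ 𝔤 𝔤 f) ^ (s + 1)) x ∈ rootSpace 𝔱 (β : 𝔱 → ℂ) := by
    convert! hmem using 2
    rw [coe_chainTop', hs]
    module
  refine ⟨e, he, _, hv, ?_, ?_⟩
  · rw [prim.lie_e_pow_succ_toEnd_f]
    refine smul_ne_zero (mul_ne_zero (by exact_mod_cast s.succ_ne_zero) ?_)
      (prim.pow_toEnd_f_ne_zero_of_eq_nat rfl (by lia))
    rw [sub_ne_zero]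
    exact_mod_cast (by lia : chainLength α β ≠ s)
  · rw [hkf]
    exact lie_mem_genWeightSpace_of_mem_genWeightSpace he hv

/-- A `𝔱`-stable subspace of a graded piece of nonzero degree is contained in any subspace which
contains the same root spaces. -/
lemma le_of_forall_rootSpace_le {h : 𝔱} {j : ℤ} (hj : j ≠ 0) {U V : Submodule ℂ 𝔤}
    (hU : U ≤ gradedPiece (h : 𝔤) j) (hstab : ∀ t : 𝔱, ∀ u ∈ U, ⁅(t : 𝔤), u⁆ ∈ U)
    (hUV : ∀ i : 𝔱.root, (rootSpace 𝔱 (i.1 : 𝔱 → ℂ)).toSubmodule ≤ U →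
      (rootSpace 𝔱 (i.1 : 𝔱 → ℂ)).toSubmodule ≤ V) : U ≤ V := by
  let N : LieSubmodule ℂ 𝔱 𝔤 := { U with lie_mem := fun {t u} hu ↦ hstab t u hu }
  have hN : N.toSubmodule = U := rfl
  have key := congrArg LieSubmodule.toSubmodule (eq_iSup_inf_genWeightSpace ℂ 𝔱 𝔤 N)
  rw [LieSubmodule.iSup_toSubmodule, hN] at key
  rw [key]
  refine iSup_le fun χ x hx ↦ ?_
  obtain ⟨hxU, hxχ⟩ : x ∈ U ∧ x ∈ rootSpace 𝔱 (χ : 𝔱 → ℂ) := hx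
  by_cases hx0 : x = 0
  · rw [hx0]
    exact V.zero_mem
  by_cases hχ : χ.IsZero
  · have h1 : ⁅(h : 𝔤), x⁆ = (j : ℂ) • x := End.mem_eigenspace_iff.mp (hU hxU)
    have h2 : ⁅(h : 𝔤), x⁆ = χ h • x := lie_eq_smul_of_mem_rootSpace hxχ h
    rw [h1, hχ.eq, Pi.zero_apply, zero_smul, smul_eq_zero] at h2
    exact absurd h2 (by simp [hj, hx0])
  · have hi : χ ∈ 𝔱.root := by simpa [LieSubalgebra.root] using hχ
    exact hUV ⟨χ, hi⟩ (rootSpace_le_of_mem (i := ⟨χ, hi⟩) hxχ hx0 hxU) hxχ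

omit [IsKilling ℂ 𝔤] in
/-- A root space lies in a sum of root spaces only if it is one of the summands. -/
lemma mem_of_rootSpace_le_iSup {A : Set 𝔱.root} {i : 𝔱.root}
    (h : (rootSpace 𝔱 (i.1 : 𝔱 → ℂ)).toSubmodule ≤
      ⨆ k : A, (rootSpace 𝔱 (k.1.1 : 𝔱 → ℂ)).toSubmodule) : i ∈ A := by
  by_contra hi
  have hind := iSupIndep_genWeightSpace' ℂ 𝔱 𝔤 i.1
  rw [← LieSubmodule.iSup_toSubmodule, LieSubmodule.toSubmodule_le_toSubmodule] at h
  refine i.1.2 (hind.eq_bot_of_le (h.trans ?_))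
  refine iSup_le fun k ↦ le_iSup₂_of_le k.1.1 (fun hk ↦ hi ?_) le_rfl
  have : k.1 = i := Subtype.ext hk
  exact this ▸ k.2

/-! ### Representatives of the elements of the Weyl group -/

/-- The reflection in a root `α` is represented by `exp(ad e) exp(-ad f) exp(ad e)`, for an
`𝔰𝔩₂`-triple with `e ∈ 𝔤_α` and `f ∈ 𝔤_{-α}`. -/
lemma exists_represents_ofIdx (i : 𝔱.root) :
    ∃ n : 𝔤 ≃ₗ[ℂ] 𝔤, Represents n (RootPairing.weylGroup.ofIdx (rootSystem 𝔱) i) := by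
  have hα := LieSubalgebra.isNonZero_coe_root i
  obtain ⟨h, e, f, ht, he, hf⟩ := exists_isSl2Triple_of_weight_isNonZero hα
  obtain rfl := ht.h_eq_coroot hα he hf
  have hexp (z : 𝔤) := endExpEquiv_mem_adGroup (𝔥 := (⊤ : Submodule ℂ 𝔤)) (z := z) trivial
  refine ⟨endExpEquiv (ad ℂ 𝔤 e) * endExpEquiv (ad ℂ 𝔤 (-f)) * endExpEquiv (ad ℂ 𝔤 e),
    mul_mem (mul_mem (hexp _) (hexp _)) (hexp _), fun t ↦ ?_⟩
  set a := (rootSystem 𝔱).root i t with ha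
  have hte : ⁅e, (t : 𝔤)⁆ = -(a • e) := by rw [← lie_skew, lie_eq_smul_of_mem he]
  have htf : ⁅f, (t : 𝔤)⁆ = a • f := by
    have : ⁅(t : 𝔤), f⁆ = -(i.1 : 𝔱 → ℂ) t • f := lie_eq_smul_of_mem_rootSpace hf t
    rw [← lie_skew, this, neg_smul, neg_neg]
    rfl
  have hhe : ⁅e, ((coroot i.1 : 𝔱) : 𝔤)⁆ = -((2 : ℂ) • e) := by
    rw [← lie_skew, ht.lie_h_e_smul ℂ]
  have hhf : ⁅f, ((coroot i.1 : 𝔱) : 𝔤)⁆ = (2 : ℂ) • f := by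
    rw [← lie_skew, ht.lie_lie_smul_f ℂ, neg_neg]
  have hfe : ⁅f, e⁆ = -((coroot i.1 : 𝔱) : 𝔤) := by rw [← lie_skew, ht.lie_e_f]
  have e1 : endExp (ad ℂ 𝔤 e) (t : 𝔤) = t - a • e := by
    rw [endExp_apply_of_pow_three (by simp [hte])]
    simp [hte, sub_eq_add_neg]
  have e2 : endExp (ad ℂ 𝔤 e) e = e := by
    rw [endExp_apply_of_pow_three (by simp)]
    simp
  have e3 : endExp (ad ℂ 𝔤 e) ((coroot i.1 : 𝔱) : 𝔤) = ((coroot i.1 : 𝔱) : 𝔤) - (2 : ℂ) • e := by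
    rw [endExp_apply_of_pow_three (by simp [hhe])]
    simp [hhe, sub_eq_add_neg]
  have f1 : endExp (ad ℂ 𝔤 (-f)) (t : 𝔤) = t - a • f := by
    rw [endExp_apply_of_pow_three (by simp [htf])]
    simp [htf, sub_eq_add_neg]
  have f2 : endExp (ad ℂ 𝔤 (-f)) e = e + (coroot i.1 : 𝔱) - f := by
    rw [endExp_apply_of_pow_three (by simp [hfe, hhf])]
    simp [hfe, hhf, sub_eq_add_neg]
  refine ⟨t - a • coroot i.1, ?_, fun k ↦ ?_⟩
  · simp only [LinearEquiv.mul_apply, endExpEquiv_apply, e1, map_sub, map_smul, f1, f2, map_add,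
      e2, e3, AddSubgroupClass.coe_sub, SetLike.val_smul]
    module
  · rw [RootPairing.weylGroupToPerm_ofIdx, RootPairing.root_reflectionPerm,
      RootPairing.reflection_apply]
    have h2 : (rootSystem 𝔱).root i (coroot i.1) = 2 := root_apply_coroot hα
    have h3 : (rootSystem 𝔱).coroot' i ((rootSystem 𝔱).root k) =
      (rootSystem 𝔱).root k (coroot i.1) := rfl
    rw [h3, LinearMap.sub_apply, LinearMap.smul_apply, map_sub, map_sub, map_smul, map_smul, h2,
      ← ha]
    simp only [smul_eq_mul]
    ring

lemma Represents.mul {n n' : 𝔤 ≃ₗ[ℂ] 𝔤} {w w' : (rootSystem 𝔱).weylGroup}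
    (h : Represents n w) (h' : Represents n' w') : Represents (n * n') (w * w') := by
  refine ⟨mul_mem h.1 h'.1, fun t ↦ ?_⟩
  obtain ⟨t', ht', hr'⟩ := h'.2 t
  obtain ⟨t'', ht'', hr''⟩ := h.2 t'
  refine ⟨t'', by rw [LinearEquiv.mul_apply, ht', ht''], fun i ↦ ?_⟩
  rw [map_mul, Equiv.Perm.mul_apply, hr'', hr']

lemma represents_one : Represents (1 : 𝔤 ≃ₗ[ℂ] 𝔤) (1 : (rootSystem 𝔱).weylGroup) := by
  refine ⟨one_mem _, fun t ↦ ⟨t, rfl, fun i ↦ ?_⟩⟩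
  rw [map_one, Equiv.Perm.one_apply]

lemma exists_represents (b : (rootSystem 𝔱).Base) (w : (rootSystem 𝔱).weylGroup) :
    ∃ n : 𝔤 ≃ₗ[ℂ] 𝔤, Represents n w := by
  obtain ⟨l, -, rfl⟩ := b.exists_word w
  induction l with
  | nil => exact ⟨1, represents_one⟩
  | cons i l ih =>
    obtain ⟨n, hn⟩ := exists_represents_ofIdx i
    obtain ⟨n', hn'⟩ := ih
    exact ⟨n * n', by
      rw [List.map_cons, List.prod_cons]
      exact hn.mul hn'⟩

/-- A representative of `w` maps the root space of `α` onto that of `w α`. -/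
lemma Represents.map_rootSpace {n : 𝔤 ≃ₗ[ℂ] 𝔤} {w : (rootSystem 𝔱).weylGroup}
    (h : Represents n w) (i : 𝔱.root) :
    (rootSpace 𝔱 (i.1 : 𝔱 → ℂ)).toSubmodule.map (n : 𝔤 →ₗ[ℂ] 𝔤) =
      (rootSpace 𝔱 (((rootSystem 𝔱).weylGroupToPerm w i).1 : 𝔱 → ℂ)).toSubmodule := by
  have ht : 𝔱.toSubmodule.map (n : 𝔤 →ₗ[ℂ] 𝔤) = 𝔱.toSubmodule := by
    refine Submodule.eq_of_le_of_finrank_eq ?_ (LinearEquiv.finrank_map_eq n _)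
    rintro _ ⟨t, ht, rfl⟩
    obtain ⟨t', ht', -⟩ := h.2 ⟨t, ht⟩
    exact ht' ▸ t'.2
  refine Submodule.eq_of_le_of_finrank_eq ?_ ?_
  · rintro _ ⟨x, hx, rfl⟩
    refine mem_rootSpace_of_lie fun t' ↦ ?_
    obtain ⟨t, htt, ht'⟩ : (t' : 𝔤) ∈ 𝔱.toSubmodule.map (n : 𝔤 →ₗ[ℂ] 𝔤) := by
      rw [ht]
      exact t'.2
    obtain ⟨t₁, h₁, hr⟩ := h.2 ⟨t, htt⟩
    obtain rfl : t₁ = t' := Subtype.ext (h₁.symm.trans ht')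
    have h2 : ⁅t, x⁆ = (rootSystem 𝔱).root i ⟨t, htt⟩ • x := lie_eq_smul_of_mem hx ⟨t, htt⟩
    rw [hr i, ← map_smul, ← h2, ← h₁]
    exact (map_lie_of_mem_adGroup h.1 t x).symm
  · rw [LinearEquiv.finrank_map_eq]
    exact (finrank_rootSpace_eq_one i.1 (LieSubalgebra.isNonZero_coe_root i)).trans
      (finrank_rootSpace_eq_one _ (LieSubalgebra.isNonZero_coe_root _)).symm

lemma Represents.map_nilradical {n : 𝔤 ≃ₗ[ℂ] 𝔤} {w : (rootSystem 𝔱).weylGroup}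
    (h : Represents n w) (b : (rootSystem 𝔱).Base) :
    (nilradical b).map (n : 𝔤 →ₗ[ℂ] 𝔤) =
      ⨆ k : ((rootSystem 𝔱).weylGroupToPerm w '' {i | b.IsPos i}),
        (rootSpace 𝔱 (k.1.1 : 𝔱 → ℂ)).toSubmodule := by
  rw [nilradical, Submodule.map_iSup]
  refine le_antisymm (iSup_le fun i ↦ ?_) (iSup_le ?_)
  · rw [h.map_rootSpace]
    exact le_iSup_of_le ⟨_, i, i.2, rfl⟩ le_rfl
  · rintro ⟨_, i, hi, rfl⟩
    rw [← h.map_rootSpace]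
    exact le_iSup_of_le ⟨i, hi⟩ le_rfl

/-! ### Subspaces stable under the Borel subgroup -/

/-- A subspace stable under `B₀` is stable under bracketing with the elements of `𝔟 ∩ 𝔤₀`. -/
lemma lie_mem_of_borelZero_stable {b : (rootSystem 𝔱).Base} {h : 𝔱} {U : Submodule ℂ 𝔤}
    (stable : ∀ g ∈ borelZero b h, ∀ u ∈ U, g u ∈ U) {z : 𝔤} (hz : z ∈ borel b)
    (hz0 : z ∈ gradedPiece (h : 𝔤) 0) {u : 𝔤} (hu : u ∈ U) : ⁅z, u⁆ ∈ U := by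
  refine mem_of_forall_endExp_smul_mem (f := ad ℂ 𝔤 z) (fun t u hu ↦ ?_) hu
  rw [← map_smul, ← endExpEquiv_apply]
  exact stable _ ⟨endExpEquiv_mem_adGroup (Submodule.smul_mem _ t hz),
    endExpEquiv_mem_adGroup (Submodule.smul_mem _ t hz0)⟩ u hu

/-- Lengths can be compared by comparing words. As the simple reflections generate the Weyl group,
the infimum defining `length` is attained by a word, and is not that of the empty set. -/
lemma length_le_of_words {b : (rootSystem 𝔱).Base} {v w : (rootSystem 𝔱).weylGroup}
    {l : List 𝔱.root} (hl : ∀ i ∈ l, i ∈ b.support)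
    (hlw : (l.map (RootPairing.weylGroup.ofIdx (rootSystem 𝔱))).prod = w)
    (h : ∀ l' : List 𝔱.root, (∀ i ∈ l', i ∈ b.support) →
      (l'.map (RootPairing.weylGroup.ofIdx (rootSystem 𝔱))).prod = v → l.length ≤ l'.length) :
    length b w ≤ length b v := by
  obtain ⟨l₁, hl₁, hv₁⟩ := b.exists_word v
  obtain ⟨l', hlen, hl', hv⟩ := Nat.sInf_mem (s := {n | ∃ l : List 𝔱.root, l.length = n ∧
    (∀ i ∈ l, i ∈ b.support) ∧ (l.map (RootPairing.weylGroup.ofIdx (rootSystem 𝔱))).prod = v})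
    ⟨_, l₁, rfl, hl₁, hv₁⟩
  have hw : length b w ≤ l.length := Nat.sInf_le ⟨l, rfl, hl, hlw⟩
  exact hw.trans ((h l' hl' hv).trans_eq hlen)

end NilpotentGrading

theorem lemma4p1 {𝔤 : Type*} [LieRing 𝔤] [LieAlgebra ℂ 𝔤] [FiniteDimensional ℂ 𝔤]
    [LieAlgebra.IsSimple ℂ 𝔤]
    (𝔱 : LieSubalgebra ℂ 𝔤) [𝔱.IsCartanSubalgebra] (b : (rootSystem 𝔱).Base)
    (x y : 𝔤) (h : 𝔱) (triple : IsSl2Triple (h : 𝔤) x y)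
    (dominant : ∀ i ∈ b.support, 0 ≤ (rootSystem 𝔱).root i h)
    (U : Submodule ℂ 𝔤) (hU : U ≤ NilpotentGrading.gradedPiece (h : 𝔤) 2)
    (stable : ∀ g ∈ NilpotentGrading.borelZero b h, ∀ u ∈ U, g u ∈ U) :
    ∃ w ∈ NilpotentGrading.minimalCosetReps b h,
      (∃ n : 𝔤 ≃ₗ[ℂ] 𝔤, NilpotentGrading.Represents n w) ∧
      ∀ n : 𝔤 ≃ₗ[ℂ] 𝔤, NilpotentGrading.Represents n w →
        U = (NilpotentGrading.nilradical b).map (n : 𝔤 →ₗ[ℂ] 𝔤) ⊓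
          NilpotentGrading.gradedPiece (h : 𝔤) 2 := by
  open NilpotentGrading in
  -- the set of roots whose root spaces make up `U`
  let S : Set 𝔱.root := {i | (rootSpace 𝔱 (i.1 : 𝔱 → ℂ)).toSubmodule ≤ U}
  let f : Dual ℂ 𝔱 →ₗ[ℂ] ℂ := Dual.eval ℂ 𝔱 h
  have hf (i : 𝔱.root) : f ((rootSystem 𝔱).root i) = (rootSystem 𝔱).root i h := rfl
  have hSc : ∀ i ∈ S, f ((rootSystem 𝔱).root i) = 2 := fun i hi ↦
    mod_cast rootSpace_le_gradedPiece_iff.mp (hi.trans hU)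
  have hS : ∀ i ∈ S, ∀ j ∈ b.posDegreeZero f, ∀ k,
      (rootSystem 𝔱).root k = (rootSystem 𝔱).root i + (rootSystem 𝔱).root j → k ∈ S := by
    rintro i hi j ⟨hj, hj0⟩ k hk
    obtain ⟨e, he, v, hv, hne, hmem⟩ := exists_lie_ne_zero hk
    refine rootSpace_le_of_mem hmem hne (lie_mem_of_borelZero_stable stable ?_ ?_ (hi hv))
    · exact Submodule.mem_sup_right (Submodule.mem_iSup_of_mem ⟨j, hj⟩ he)
    · exact rootSpace_le_gradedPiece_iff.mpr (by rw [Int.cast_zero, ← hf, hj0]) he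
  -- the subgroup `B₀` contains `exp (ad t)` because `𝔱` is abelian, hence in degree zero
  have hcomm (t : 𝔱) : ⁅(h : 𝔤), (t : 𝔤)⁆ = 0 :=
    congrArg Subtype.val (trivial_lie_zero 𝔱 𝔱 h t)
  have hlie_t : ∀ t : 𝔱, ∀ u : 𝔤, u ∈ U → ⁅(t : 𝔤), u⁆ ∈ U := fun t u hu ↦
    lie_mem_of_borelZero_stable stable (Submodule.mem_sup_left t.2)
      (End.mem_eigenspace_iff.mpr (by
        rw [Int.cast_zero, zero_smul, ad_apply, hcomm])) hu
  obtain ⟨w, hwS, l, hl, hlw, hmin⟩ :=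
    RootPairing.Base.exists_weylGroup_of_stable (two_ne_zero (α := ℂ)) hSc hS
  refine ⟨w, fun u hu ↦ length_le_of_words hl hlw (hmin u hu), exists_represents b w, fun n hn ↦ ?_⟩
  have hroots (i : 𝔱.root) : (rootSpace 𝔱 (i.1 : 𝔱 → ℂ)).toSubmodule ≤ U ↔
      (rootSpace 𝔱 (i.1 : 𝔱 → ℂ)).toSubmodule ≤
        (nilradical b).map (n : 𝔤 →ₗ[ℂ] 𝔤) ⊓ gradedPiece (h : 𝔤) 2 := by
    rw [hn.map_nilradical b, le_inf_iff, rootSpace_le_gradedPiece_iff]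
    obtain ⟨j, rfl⟩ := ((rootSystem 𝔱).weylGroupToPerm w).surjective i
    constructor
    · intro hi
      have hi2 := hSc _ hi
      have hj := (hwS j hi2).mp hi
      exact ⟨le_iSup_of_le ⟨_, j, hj, rfl⟩ le_rfl, by exact_mod_cast hi2⟩
    · rintro ⟨hle, h2⟩
      obtain ⟨j', hj', heq⟩ := mem_of_rootSpace_le_iSup hle
      obtain rfl := ((rootSystem 𝔱).weylGroupToPerm w).injective heq
      exact (hwS j' (by exact_mod_cast h2)).mpr hj'
  refine le_antisymm (le_of_forall_rootSpace_le two_ne_zero hU hlie_t fun i ↦ (hroots i).mp)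
    (le_of_forall_rootSpace_le two_ne_zero inf_le_right (fun t u hu ↦ ⟨?_, ?_⟩)
      fun i ↦ (hroots i).mpr)
  · have hu1 := hu.1
    rw [hn.map_nilradical b, ← LieSubmodule.iSup_toSubmodule] at hu1 ⊢
    exact LieSubmodule.lie_mem (x := t) _ hu1
  · have hu2 : ⁅(h : 𝔤), u⁆ = ((2 : ℤ) : ℂ) • u := End.mem_eigenspace_iff.mp hu.2
    refine End.mem_eigenspace_iff.mpr ?_
    rw [ad_apply, leibniz_lie, hu2, lie_smul, hcomm, zero_lie, zero_add]
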